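/- An \emph{operator space} is a complex Banach space $X$ together with the norms $\|\cdot\|_{M_n(X)}$ on the spaces $M_n(X)$ of $n\times n$ matrices over $X$ that are induced by an isometric embedding $X\to B(H)$ for some Hilbert space $H$, through $M_n(B(H))\cong B(H^{\oplus n})$. A linear map $u\colon X\to Y$ between operator spaces is a \emph{complete isometric embedding} if $\|[u(x_{ij})]\|_{M_n(Y)}=\|[x_{ij}]\|_{M_n(X)}$ for all $n$ and all $[x_{ij}]\in M_n(X)$; it is a \emph{complete isomorphic embedding} if it is injective and there is $C>0$ with $C^{-1}\|[x_{ij}]\|_{M_n(X)}\le\|[u(x_{ij})]\|_{M_n(Y)}\le C\|[x_{ij}]\|_{M_n(X)}$ for all $n$ and all $[x_{ij}]\in M_n(X)$. $X$ is \emph{Hilbertian} if it is isomorphic, as a Banach space, to $\ell_2$. For a sequence of operator spaces, $(\bigoplus_k Y_k)_{c_0}$ is the space of sequences $(y_k)_k$ with $y_k\in Y_k$ and $\|y_k\|\to0$, with $\|[y_{ij}]\|_{M_n}=\sup_k\|[y_{ij}(k)]\|_{M_n(Y_k)}$; $c_0(Y)$ is the case $Y_k=Y$ for all $k\in\mathbb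 N$; and $X\oplus Y$ carries the maximum of the two matrix norms. For a Banach space $E$, \[\|[x_{ij}]\|_{M_n(\mathrm{MIN}(E))}=\sup_{f\in B_{E^*}}\|[f(x_{ij})]\|_{M_n(\mathbb C)},\qquad \|[x_{ij}]\|_{M_n(\mathrm{MAX}(E))}=\sup_{u}\|[u(x_{ij})]\|_{B(H_u^{\oplus n})},\] where $u$ runs over all linear contractions of $E$ into $B(H_u)$, $H_u$ a Hilbert space. \textbf{Theorem.} (1) There are separable Hilbertian operator spaces $X$ and $Y$ such that $X$ completely isometrically embeds into $c_0(Y)$, but $X$ does not completely isomorphically embed into $Y$. (2) Explicitly, let $Y=\mathrm{MIN}(\ell_2)\oplus\mathrm{MAX}(\ell_2)$, let $(S_k)_{k\in\mathbb N}$ be any partition of $\mathbb N$ into finite nonempty sets with $\lim_k|S_k|=\infty$, and let $X$ be $\ell_2$ with the operator space structure given by the isometric embedding \[x\mapsto\big(x,(x|_{S_k})_k\big)\in\mathrm{MIN}(\ell_2)\oplus\Big(\bigoplus_k\mathrm{MAX}(\ell_2(S_k))\Big)_{c_0}.\] Then $X$ and $Y$ are separable and Hilbertian, $X$ completely isometrically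 embeds into $c_0(Y)$, and $X$ does not completely isomorphically embed into $Y$. -/

import Mathlib

open Filter Topology
open scoped ENNReal lp

noncomputable section

namespace OpSp

/-! ### Matrices of operators -/

section MatOp

variable {H : Type} [NormedAddCommGroup H] [InnerProductSpace ℂ H]

/-- The identification `M_n(B(H)) ≅ B(H^{⊕n})`: the matrix `A` acts on the `ℓ₂`-sum of `n` copies
of `H` by `(A ξ)_i = ∑ j, A_{ij} ξ_j`. -/
def matOp {n : ℕ} (A : Matrix (Fin n) (Fin n) (H →L[ℂ] H)) :
    PiLp 2 (fun _ : Fin n => H) →L[ℂ] PiLp 2 (fun _ : Fin n => H) :=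
  ((PiLp.continuousLinearEquiv 2 ℂ (fun _ : Fin n => H)).symm :
      (Fin n → H) →L[ℂ] PiLp 2 (fun _ : Fin n => H)) ∘L
    (ContinuousLinearMap.pi fun i => ∑ j, A i j ∘L
      (ContinuousLinearMap.proj (R := ℂ) (φ := fun _ : Fin n => H) j)) ∘L
    ((PiLp.continuousLinearEquiv 2 ℂ (fun _ : Fin n => H)) :
      PiLp 2 (fun _ : Fin n => H) →L[ℂ] (Fin n → H))

@[simp]
theorem matOp_apply {n : ℕ} (A : Matrix (Fin n) (Fin n) (H →L[ℂ] H))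
    (ξ : PiLp 2 (fun _ : Fin n => H)) (i : Fin n) : matOp A ξ i = ∑ j, A i j (ξ j) := by
  simp [matOp]

theorem norm_matOp_le {n : ℕ} (A : Matrix (Fin n) (Fin n) (H →L[ℂ] H)) :
    ‖matOp A‖ ≤ Real.sqrt (∑ i : Fin n, (∑ j : Fin n, ‖A i j‖) ^ 2) := by
  refine ContinuousLinearMap.opNorm_le_bound _ (Real.sqrt_nonneg _) fun ξ => ?_
  have hξ : ∀ j, ‖ξ j‖ ≤ ‖ξ‖ := fun j => PiLp.norm_apply_le ξ j
  rw [← Real.sqrt_sq (norm_nonneg ξ), ← Real.sqrt_mul (by positivity),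
    ← Real.sqrt_sq (norm_nonneg (matOp A ξ))]
  apply Real.sqrt_le_sqrt
  rw [PiLp.norm_sq_eq_of_L2, Finset.sum_mul]
  refine Finset.sum_le_sum fun i _ => ?_
  rw [← mul_pow]
  refine pow_le_pow_left₀ (norm_nonneg _) ?_ 2
  rw [matOp_apply, Finset.sum_mul]
  refine (norm_sum_le _ _).trans (Finset.sum_le_sum fun j _ => ?_)
  exact ((A i j).le_opNorm _).trans (by gcongr; exact hξ j)

theorem norm_matOp_one (A : H →L[ℂ] H) :
    ‖matOp (Matrix.of fun _ _ : Fin 1 => A)‖ = ‖A‖ := by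
  apply le_antisymm
  · refine (norm_matOp_le _).trans ?_
    simp [Real.sqrt_sq]
  · refine ContinuousLinearMap.opNorm_le_bound _ (norm_nonneg (matOp (Matrix.of fun _ _ : Fin 1 => A))) fun x => ?_
    have h := (matOp (Matrix.of fun _ _ : Fin 1 => A)).le_opNorm (WithLp.toLp 2 fun _ : Fin 1 => x)
    have e1 : ‖(WithLp.toLp 2 (fun _ : Fin 1 => x) : PiLp 2 (fun _ : Fin 1 => H))‖ = ‖x‖ := by
      rw [PiLp.norm_eq_of_L2]; simp [Real.sqrt_sq]
    have e2 : ‖matOp (Matrix.of fun _ _ : Fin 1 => A) (WithLp.toLp 2 fun _ : Fin 1 => x)‖ = ‖A x‖ := by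
      rw [PiLp.norm_eq_of_L2]; simp [Real.sqrt_sq]
    rwa [e1, e2] at h

end MatOp

/-! ### Operator spaces -/

/-- An operator space structure on a complex Banach space `X`: the sequence of norms of the spaces
`M_n(X)` of matrices that is induced by an isometric embedding of `X` into some `B(H)`. -/
structure OperatorSpaceStructure (X : Type) [NormedAddCommGroup X] [NormedSpace ℂ X]
    [CompleteSpace X] where
  /-- The norm of `M_n(X)`. -/
  matNorm : ∀ n : ℕ, Matrix (Fin n) (Fin n) X → ℝ
  exists_embedding : ∃ (H : Type) (_ : NormedAddCommGroup H) (_ : InnerProductSpace ℂ H)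
    (_ : CompleteSpace H) (J : X →ₗᵢ[ℂ] (H →L[ℂ] H)),
    ∀ (n : ℕ) (x : Matrix (Fin n) (Fin n) X), matNorm n x = ‖matOp (x.map J)‖

/-- A contraction `u : X → B(H)`, for some Hilbert space `H`. -/
structure Contraction (X : Type) [NormedAddCommGroup X] [NormedSpace ℂ X] where
  H : Type
  [normedAddCommGroup : NormedAddCommGroup H]
  [innerProductSpace : InnerProductSpace ℂ H]
  [completeSpace : CompleteSpace H]
  u : X →L[ℂ] (H →L[ℂ] H)
  norm_le : ‖u‖ ≤ 1

attribute [instance] Contraction.normedAddCommGroup Contraction.innerProductSpace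
  Contraction.completeSpace

section Sum

variable {X : Type} [NormedAddCommGroup X] [NormedSpace ℂ X] {ι : Type} (Φ : ι → Contraction X)

theorem Contraction.norm_apply_le (c : Contraction X) (x : X) : ‖c.u x‖ ≤ ‖x‖ :=
  (c.u.le_opNorm x).trans (mul_le_of_le_one_left (norm_nonneg x) c.norm_le)

theorem Contraction.norm_apply_apply_le (c : Contraction X) (x : X) (ξ : c.H) :
    ‖c.u x ξ‖ ≤ ‖x‖ * ‖ξ‖ :=
  ((c.u x).le_opNorm ξ).trans (mul_le_mul_of_nonneg_right (c.norm_apply_le x) (norm_nonneg ξ))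

/-- The `ℓ₂`-sum of the Hilbert spaces on which a family of contractions lives. -/
abbrev SumSpace : Type := lp (fun i => (Φ i).H) 2

theorem memℓp_diag (x : X) (ξ : SumSpace Φ) :
    Memℓp (fun i => (Φ i).u x (ξ i)) 2 := by
  refine memℓp_gen ?_
  have h := ((lp.memℓp ξ).summable (by norm_num)).mul_left (‖x‖ ^ (2 : ℝ≥0∞).toReal)
  refine h.of_nonneg_of_le (fun i => by positivity) fun i => ?_
  rw [← Real.mul_rpow (norm_nonneg _) (norm_nonneg _)]
  exact Real.rpow_le_rpow (norm_nonneg _) ((Φ i).norm_apply_apply_le x (ξ i)) (by simp)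

/-- The diagonal operator with diagonal entries `u_i(x)`. -/
def diag (x : X) : SumSpace Φ →L[ℂ] SumSpace Φ :=
  LinearMap.mkContinuous
    { toFun := fun ξ => ⟨fun i => (Φ i).u x (ξ i), memℓp_diag Φ x ξ⟩
      map_add' := fun ξ η => by ext i; exact ((Φ i).u x).map_add (ξ i) (η i)
      map_smul' := fun c ξ => by ext i; exact ((Φ i).u x).map_smul c (ξ i) } ‖x‖ fun ξ => by
    have h2 : (2 : ℝ≥0∞) ≠ 0 := by simp
    have hn : ‖x‖ * ‖ξ‖ = ‖(‖x‖ : ℂ) • ξ‖ := by rw [norm_smul]; simp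
    rw [hn]
    refine lp.norm_mono h2 fun i => ?_
    refine ((Φ i).norm_apply_apply_le x (ξ i)).trans (le_of_eq ?_)
    rw [lp.coeFn_smul, Pi.smul_apply, norm_smul]
    simp

@[simp]
theorem diag_apply (x : X) (ξ : SumSpace Φ) (i : ι) : diag Φ x ξ i = (Φ i).u x (ξ i) := rfl

theorem norm_sq_lp (ξ : SumSpace Φ) : HasSum (fun i => ‖ξ i‖ ^ 2) (‖ξ‖ ^ 2) := by
  have h := lp.hasSum_norm (p := 2) (by norm_num) ξ
  simpa using h

theorem norm_matOp_diag_le {n : ℕ} (x : Matrix (Fin n) (Fin n) X) {C : ℝ} (hC : 0 ≤ C)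
    (h : ∀ i, ‖matOp (x.map (Φ i).u)‖ ≤ C) : ‖matOp (x.map (diag Φ))‖ ≤ C := by
  refine ContinuousLinearMap.opNorm_le_bound _ hC fun ξ => ?_
  refine le_of_sq_le_sq ?_ (by positivity)
  rw [mul_pow, PiLp.norm_sq_eq_of_L2, PiLp.norm_sq_eq_of_L2]
  have h1 := hasSum_sum (s := Finset.univ) fun p (_ : p ∈ Finset.univ) =>
    norm_sq_lp Φ (matOp (x.map (diag Φ)) ξ p)
  have h2 := (hasSum_sum (s := Finset.univ) fun p (_ : p ∈ Finset.univ) =>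
    norm_sq_lp Φ (ξ p)).mul_left (C ^ 2)
  refine hasSum_le (fun i => ?_) h1 h2
  let η : PiLp 2 (fun _ : Fin n => (Φ i).H) := WithLp.toLp 2 fun p => ξ p i
  have h3 := ((matOp (x.map (Φ i).u)).le_opNorm η).trans
    (mul_le_mul_of_nonneg_right (h i) (norm_nonneg η))
  have h4 := pow_le_pow_left₀ (norm_nonneg _) h3 2
  rw [mul_pow, PiLp.norm_sq_eq_of_L2, PiLp.norm_sq_eq_of_L2] at h4
  refine le_trans (le_of_eq ?_) h4
  refine Finset.sum_congr rfl fun p _ => ?_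
  rw [matOp_apply, matOp_apply, lp.coeFn_sum, Finset.sum_apply]
  rfl

theorem le_norm_matOp_diag {n : ℕ} (x : Matrix (Fin n) (Fin n) X) (i : ι) :
    ‖matOp (x.map (Φ i).u)‖ ≤ ‖matOp (x.map (diag Φ))‖ := by
  classical
  refine ContinuousLinearMap.opNorm_le_bound _ (norm_nonneg _) fun η => ?_
  let ξ : PiLp 2 (fun _ : Fin n => SumSpace Φ) :=
    WithLp.toLp 2 fun p => lp.single (E := fun i => (Φ i).H) 2 i (η p)
  have h1 : ‖ξ‖ = ‖η‖ := by
    rw [PiLp.norm_eq_of_L2, PiLp.norm_eq_of_L2]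
    congr 1
    refine Finset.sum_congr rfl fun p _ => ?_
    change ‖lp.single (E := fun i => (Φ i).H) 2 i (η p)‖ ^ 2 = _
    rw [lp.norm_single (by norm_num)]
  have h2 := (matOp (x.map (diag Φ))).le_opNorm ξ
  rw [h1] at h2
  refine le_trans ?_ h2
  rw [PiLp.norm_eq_of_L2, PiLp.norm_eq_of_L2]
  refine Real.sqrt_le_sqrt (Finset.sum_le_sum fun p _ => ?_)
  refine pow_le_pow_left₀ (norm_nonneg _) ?_ 2
  refine le_trans (le_of_eq ?_) (lp.norm_apply_le_norm (by norm_num) _ i)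
  rw [matOp_apply, matOp_apply, lp.coeFn_sum, Finset.sum_apply]
  congr 1
  refine Finset.sum_congr rfl fun q _ => ?_
  change _ = (Φ i).u (x p q) (lp.single (E := fun i => (Φ i).H) 2 i (η q) i)
  rw [lp.single_apply_self]
  rfl

/-- The diagonal representation `x ↦ (u_i(x))_i` realises suprema of matrix norms. -/
theorem exists_embedding_of_family {X : Type} [NormedAddCommGroup X] [NormedSpace ℂ X]
    {ι : Type} (Φ : ι → Contraction X) (N : ∀ n : ℕ, Matrix (Fin n) (Fin n) X → ℝ)
    (hN : ∀ (n : ℕ) (x : Matrix (Fin n) (Fin n) X), IsLUB (Set.range fun i : ι => ‖matOp (x.map (Φ i).u)‖) (N n x))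
    (h0 : Nonempty ι)
    (h1 : ∀ x : X, ‖x‖ ≤ N 1 (Matrix.of fun _ _ => x)) :
    ∃ (H : Type) (_ : NormedAddCommGroup H) (_ : InnerProductSpace ℂ H)
      (_ : CompleteSpace H) (J : X →ₗᵢ[ℂ] (H →L[ℂ] H)),
      ∀ (n : ℕ) (x : Matrix (Fin n) (Fin n) X), N n x = ‖matOp (x.map J)‖ := by
  have key : ∀ (n : ℕ) (x : Matrix (Fin n) (Fin n) X), 
      N n x = ‖matOp (H := SumSpace Φ) (x.map (diag Φ))‖ := by
    intro n x
    apply le_antisymm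
    · refine (hN n x).2 ?_
      rintro _ ⟨i, rfl⟩
      exact le_norm_matOp_diag Φ x i
    · have hle : ∀ i, ‖matOp (x.map (Φ i).u)‖ ≤ N n x := fun i => (hN n x).1 ⟨i, rfl⟩
      exact norm_matOp_diag_le Φ x ((norm_nonneg _).trans (hle h0.some)) hle
  refine ⟨SumSpace Φ, inferInstance, inferInstance, inferInstance,
    { toFun := diag Φ
      map_add' := fun x y => by ext ξ i; simp
      map_smul' := fun c x => by ext ξ i; simp
      norm_map' := fun x => ?_ }, key⟩
  change ‖diag Φ x‖ = ‖x‖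
  apply le_antisymm
  · exact LinearMap.mkContinuous_norm_le _ (norm_nonneg x) _
  · refine (h1 x).trans (le_of_eq ?_)
    rw [key]
    exact norm_matOp_one (diag Φ x)

end Sum

namespace OperatorSpaceStructure

section Basic

variable {X Y : Type} [NormedAddCommGroup X] [NormedSpace ℂ X]
  [NormedAddCommGroup Y] [NormedSpace ℂ Y] [CompleteSpace Y]

theorem matNorm_one (s : OperatorSpaceStructure Y) (x : Y) :
    s.matNorm 1 (Matrix.of fun _ _ => x) = ‖x‖ := by
  obtain ⟨H, i1, i2, i3, J, hJ⟩ := s.exists_embedding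
  rw [hJ, ← J.norm_map x, ← norm_matOp_one (J x)]
  rfl

theorem exists_contraction (s : OperatorSpaceStructure Y) (T : X →L[ℂ] Y) (hT : ‖T‖ ≤ 1) :
    ∃ c : Contraction X, ∀ (n : ℕ) (x : Matrix (Fin n) (Fin n) X),
      s.matNorm n (x.map T) = ‖matOp (x.map c.u)‖ := by
  obtain ⟨H, i1, i2, i3, J, hJ⟩ := s.exists_embedding
  refine ⟨⟨H, J.toContinuousLinearMap ∘L T, ?_⟩, fun n x => ?_⟩
  · refine ContinuousLinearMap.opNorm_le_bound _ zero_le_one fun x => ?_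
    change ‖J (T x)‖ ≤ _
    rw [J.norm_map]
    exact (T.le_opNorm x).trans (mul_le_mul_of_nonneg_right hT (norm_nonneg x))
  · rw [hJ]
    rfl

/-- The operator space structure on `X` given by an isometric embedding of `X` into an operator
space `Y`. -/
def ofEmbedding [CompleteSpace X] (s : OperatorSpaceStructure Y) (T : X →ₗᵢ[ℂ] Y) : OperatorSpaceStructure X where
  matNorm n x := s.matNorm n (x.map T)
  exists_embedding := by
    obtain ⟨H, i1, i2, i3, J, hJ⟩ := s.exists_embedding
    exact ⟨H, i1, i2, i3, J.comp T, fun n x => by rw [hJ]; rfl⟩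

end Basic

/-! ### `MIN` and `MAX` -/

section MinMax

variable (X : Type) [NormedAddCommGroup X] [NormedSpace ℂ X]

/-- The contraction into `B(ℂ)` given by a functional in the unit ball of the dual. -/
abbrev functionalContraction (f : {f : X →L[ℂ] ℂ // ‖f‖ ≤ 1}) : Contraction X where
  H := ℂ
  u := (ContinuousLinearMap.mul ℂ ℂ) ∘L f.1
  norm_le := by
    refine ContinuousLinearMap.opNorm_le_bound _ zero_le_one fun x => ?_
    have : ‖f.1 x‖ ≤ 1 * ‖x‖ :=
      (f.1.le_opNorm x).trans (mul_le_mul_of_nonneg_right f.2 (norm_nonneg x))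
    simpa using this

theorem functionalContraction_matOp (f : {f : X →L[ℂ] ℂ // ‖f‖ ≤ 1}) {n : ℕ}
    (x : Matrix (Fin n) (Fin n) X) :
    matOp (x.map (functionalContraction X f).u) = Matrix.toEuclideanCLM (𝕜 := ℂ) (x.map f.1) := by
  ext ξ i
  change matOp (H := ℂ) _ ξ i = _
  rw [matOp_apply]
  simp [functionalContraction, Matrix.mulVec, dotProduct]

theorem bddAbove_contraction {n : ℕ} (x : Matrix (Fin n) (Fin n) X) :
    BddAbove (Set.range fun c : Contraction X => ‖matOp (x.map c.u)‖) := by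
  refine ⟨Real.sqrt (∑ i : Fin n, (∑ j : Fin n, ‖x i j‖) ^ 2), ?_⟩
  rintro _ ⟨c, rfl⟩
  refine (norm_matOp_le _).trans (Real.sqrt_le_sqrt ?_)
  gcongr with i _ j _
  exact c.norm_apply_le (x i j)

theorem exists_functional_norm_le (x : X) : ∃ f : {f : X →L[ℂ] ℂ // ‖f‖ ≤ 1},
    ‖x‖ ≤ ‖matOp (Matrix.of fun _ _ : Fin 1 => (functionalContraction X f).u x)‖ := by
  obtain ⟨f, hf, hfx⟩ := exists_dual_vector'' ℂ x
  refine ⟨⟨f, hf⟩, ?_⟩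
  rw [norm_matOp_one]
  change ‖x‖ ≤ ‖ContinuousLinearMap.mul ℂ ℂ (f x)‖
  simp [hfx]

variable [CompleteSpace X]

/-- `MIN(X)`: the structure given by `X ⊆ C(B_{X*})`. As `M_n(C(K))` carries the norm
`sup_{t ∈ K} ‖[g_{ij}(t)]‖_{M_n}`, this is the supremum of the operator norms of the scalar
matrices `[f(x_{ij})]` (acting on the Euclidean space `ℂⁿ`), over `f` in the dual unit ball. -/
def MIN : OperatorSpaceStructure X where
  matNorm n x := ⨆ f : {f : X →L[ℂ] ℂ // ‖f‖ ≤ 1}, ‖Matrix.toEuclideanCLM (𝕜 := ℂ) (x.map f.1)‖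
  exists_embedding := by
    have hb : ∀ (n : ℕ) (x : Matrix (Fin n) (Fin n) X), IsLUB
        (Set.range fun f => ‖matOp (x.map (functionalContraction X f).u)‖)
        (⨆ f : {f : X →L[ℂ] ℂ // ‖f‖ ≤ 1}, ‖Matrix.toEuclideanCLM (𝕜 := ℂ) (x.map f.1)‖) := by
      intro n x
      simp_rw [← functionalContraction_matOp]
      have : Nonempty {f : X →L[ℂ] ℂ // ‖f‖ ≤ 1} := ⟨⟨0, by simp⟩⟩
      refine isLUB_ciSup ((bddAbove_contraction X x).mono ?_)
      rintro _ ⟨f, rfl⟩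
      exact ⟨functionalContraction X f, rfl⟩
    refine exists_embedding_of_family (functionalContraction X) _ hb ⟨⟨0, by simp⟩⟩ fun x => ?_
    obtain ⟨f, hf⟩ := exists_functional_norm_le X x
    exact hf.trans ((hb 1 (Matrix.of fun _ _ => x)).1 ⟨f, rfl⟩)

/-- `MAX(X)`: the structure given by `x ↦ (u(x))_u`, where `u` runs over all contractions of `X`
into some `B(H)`. -/
def MAX : OperatorSpaceStructure X where
  matNorm n x := ⨆ c : Contraction X, ‖matOp (x.map c.u)‖
  exists_embedding := by
    have : Nonempty (Contraction X) := ⟨functionalContraction X ⟨0, by simp⟩⟩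
    let ι := {p : (Σ n : ℕ, Matrix (Fin n) (Fin n) X) × ℝ //
      ∃ c : Contraction X, ‖matOp (p.1.2.map c.u)‖ = p.2}
    let Φ : ι → Contraction X := fun p => p.2.choose
    have hΦ : ∀ p : ι, ‖matOp (p.1.1.2.map (Φ p).u)‖ = p.1.2 := fun p => p.2.choose_spec
    have hb : ∀ (n : ℕ) (x : Matrix (Fin n) (Fin n) X), IsLUB
        (Set.range fun i => ‖matOp (x.map (Φ i).u)‖)
        (⨆ c : Contraction X, ‖matOp (x.map c.u)‖) := by
      intro n x
      constructor
      · rintro _ ⟨i, rfl⟩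
        exact le_ciSup (bddAbove_contraction X x) (Φ i)
      · intro b hb
        refine ciSup_le fun c => hb ?_
        exact ⟨⟨(⟨n, x⟩, ‖matOp (x.map c.u)‖), c, rfl⟩, hΦ ⟨(⟨n, x⟩, ‖matOp (x.map c.u)‖), c, rfl⟩⟩
    refine exists_embedding_of_family Φ _ hb ?_ fun x => ?_
    · let c : Contraction X := functionalContraction X ⟨0, by simp⟩
      let x : Matrix (Fin 0) (Fin 0) X := Matrix.of fun _ _ => 0
      exact ⟨⟨(⟨0, x⟩, ‖matOp (x.map c.u)‖), c, rfl⟩⟩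
    · obtain ⟨f, hf⟩ := exists_functional_norm_le X x
      exact hf.trans (le_ciSup (bddAbove_contraction X (Matrix.of fun _ _ : Fin 1 => x))
        (functionalContraction X f))

end MinMax

/-! ### Direct sums -/

section Prod

variable {X Y : Type} [NormedAddCommGroup X] [NormedSpace ℂ X] [CompleteSpace X]
  [NormedAddCommGroup Y] [NormedSpace ℂ Y] [CompleteSpace Y]

/-- The sum `X ⊕_∞ Y` of two operator spaces, on `X × Y` with its maximum norm. -/
def prod (s : OperatorSpaceStructure X) (t : OperatorSpaceStructure Y) :
    OperatorSpaceStructure (X × Y) where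
  matNorm n x := max (s.matNorm n (x.map Prod.fst)) (t.matNorm n (x.map Prod.snd))
  exists_embedding := by
    obtain ⟨c, hc⟩ := s.exists_contraction (ContinuousLinearMap.fst ℂ X Y)
      (ContinuousLinearMap.norm_fst_le ..)
    obtain ⟨d, hd⟩ := t.exists_contraction (ContinuousLinearMap.snd ℂ X Y)
      (ContinuousLinearMap.norm_snd_le ..)
    refine exists_embedding_of_family (fun b : Bool => cond b c d) _ (fun n x => ?_) ⟨true⟩
      fun x => ?_
    · have e1 : s.matNorm n (x.map Prod.fst) = _ := hc n x
      have e2 : t.matNorm n (x.map Prod.snd) = _ := hd n x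
      rw [e1, e2]
      constructor
      · rintro _ ⟨_ | _, rfl⟩
        · exact le_max_right ‖matOp (x.map c.u)‖ ‖matOp (x.map d.u)‖
        · exact le_max_left ‖matOp (x.map c.u)‖ ‖matOp (x.map d.u)‖
      · intro b hb
        exact max_le (hb ⟨true, rfl⟩) (hb ⟨false, rfl⟩)
    · exact le_of_eq (congrArg₂ (fun a b : ℝ => max a b) (s.matNorm_one x.1) (t.matNorm_one x.2)).symm

end Prod

end OperatorSpaceStructure

section C0

variable (Y : ℕ → Type) [∀ k, NormedAddCommGroup (Y k)] [∀ k, NormedSpace ℂ (Y k)]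

/-- The subspace of the `ℓ_∞`-sum of the `Y k` of all sequences with `‖y_k‖ → 0`. -/
def c0Submodule : Submodule ℂ (lp Y ∞) where
  carrier := {y | Tendsto (fun k => ‖y k‖) atTop (𝓝 0)}
  zero_mem' := by simp
  add_mem' := by
    intro y z hy hz
    refine squeeze_zero (fun k => norm_nonneg _) (fun k => norm_add_le (y k) (z k)) ?_
    simpa using Tendsto.add hy hz
  smul_mem' := by
    intro c y hy
    have := Tendsto.const_mul ‖c‖ hy
    simpa [norm_smul] using this

/-- The Banach space `(⊕_k Y_k)_{c₀}`. -/
abbrev C0Sum : Type := c0Submodule Y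

instance C0Sum.completeSpace [∀ k, CompleteSpace (Y k)] : CompleteSpace (C0Sum Y) := by
  have hcl : IsClosed (c0Submodule Y : Set (lp Y ∞)) := by
    rw [← isSeqClosed_iff_isClosed]
    intro y z hy hz
    change Tendsto (fun k => ‖z k‖) atTop (𝓝 0)
    rw [Metric.tendsto_atTop]
    intro ε hε
    obtain ⟨m, hm⟩ := (Metric.tendsto_atTop.1 hz (ε / 2) (half_pos hε))
    obtain ⟨K, hK⟩ := (Metric.tendsto_atTop.1 (hy m) (ε / 2) (half_pos hε))
    refine ⟨K, fun k hk => ?_⟩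
    have h1 := hm m le_rfl
    have h2 := hK k hk
    rw [dist_eq_norm] at h1
    have h3 : ‖(y m - z) k‖ ≤ ‖y m - z‖ := lp.norm_apply_le_norm (by simp) _ k
    have h4 : ‖z k‖ ≤ ‖(y m) k‖ + ‖(y m - z) k‖ := by
      have e : z k = (y m) k - (y m - z) k := by simp
      rw [e]
      simpa using norm_sub_le ((y m) k) ((y m - z) k)
    simp only [dist_zero_right, norm_norm] at h2 ⊢
    linarith
  exact hcl.completeSpace_coe

/-- The canonical projection onto the `k`-th summand. -/
def C0Sum.proj (k : ℕ) : C0Sum Y →L[ℂ] Y k :=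
  (lp.evalCLM ℂ Y (p := ∞) k) ∘L (c0Submodule Y).subtypeL

variable {Y}

theorem C0Sum.norm_proj_le (k : ℕ) : ‖C0Sum.proj Y k‖ ≤ 1 := by
  refine ContinuousLinearMap.opNorm_le_bound _ zero_le_one fun y => ?_
  rw [one_mul]
  exact lp.norm_apply_le_norm (by simp) y.1 k

variable [∀ k, CompleteSpace (Y k)]

/-- The `c₀`-sum `(⊕_k Y_k)_{c₀}` of a sequence of operator spaces. -/
def OperatorSpaceStructure.c0Sum (s : ∀ k, OperatorSpaceStructure (Y k)) :
    OperatorSpaceStructure (C0Sum Y) where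
  matNorm n x := ⨆ k, (s k).matNorm n (x.map fun y => y.1 k)
  exists_embedding := by
    choose c hc using fun k =>
      (s k).exists_contraction (C0Sum.proj Y k) (C0Sum.norm_proj_le k)
    have hb : ∀ (n : ℕ) (x : Matrix (Fin n) (Fin n) (C0Sum Y)), IsLUB
        (Set.range fun k => ‖matOp (x.map (c k).u)‖)
        (⨆ k, (s k).matNorm n (x.map fun y => y.1 k)) := by
      intro n x
      have e : ∀ k, (s k).matNorm n (x.map fun y => y.1 k) = ‖matOp (x.map (c k).u)‖ :=
        fun k => hc k n x
      simp_rw [e]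
      refine isLUB_ciSup ((bddAbove_contraction _ x).mono ?_)
      rintro _ ⟨k, rfl⟩
      exact ⟨c k, rfl⟩
    refine exists_embedding_of_family c _ hb ⟨0⟩ fun x => ?_
    have e : ∀ k, (s k).matNorm 1 (Matrix.of fun _ _ => x.1 k) = ‖x.1 k‖ :=
      fun k => (s k).matNorm_one (x.1 k)
    change ‖x.1‖ ≤ ⨆ k, (s k).matNorm 1 (Matrix.of fun _ _ => x.1 k)
    simp_rw [e]
    exact le_of_eq (lp.norm_eq_ciSup x.1)

/-- `c₀(Y)`: the `c₀`-sum of countably many copies of the operator space `Y`. -/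
def OperatorSpaceStructure.c0 {Z : Type} [NormedAddCommGroup Z] [NormedSpace ℂ Z]
    [CompleteSpace Z] (s : OperatorSpaceStructure Z) :
    OperatorSpaceStructure (C0Sum fun _ : ℕ => Z) :=
  OperatorSpaceStructure.c0Sum fun _ => s

end C0

/-! ### Maps between operator spaces -/

section Maps

variable {X Y : Type} [NormedAddCommGroup X] [NormedSpace ℂ X] [CompleteSpace X]
  [NormedAddCommGroup Y] [NormedSpace ℂ Y] [CompleteSpace Y]

/-- `X` completely isometrically embeds into `Y`: some linear map `X → Y` has isometric
amplifications `M_n(X) → M_n(Y)` for all `n`. -/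
def CompletelyIsometricallyEmbeds (s : OperatorSpaceStructure X)
    (t : OperatorSpaceStructure Y) : Prop :=
  ∃ u : X →ₗ[ℂ] Y, ∀ (n : ℕ) (x : Matrix (Fin n) (Fin n) X),
    t.matNorm n (x.map u) = s.matNorm n x

/-- `X` completely isomorphically embeds into `Y`: some injective linear map `u : X → Y` is
completely bounded, and so is its inverse `u⁻¹ : u(X) → X`. -/
def CompletelyIsomorphicallyEmbeds (s : OperatorSpaceStructure X)
    (t : OperatorSpaceStructure Y) : Prop :=
  ∃ u : X →ₗ[ℂ] Y, Function.Injective u ∧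
    (∃ C : ℝ, ∀ (n : ℕ) (x : Matrix (Fin n) (Fin n) X),
      t.matNorm n (x.map u) ≤ C * s.matNorm n x) ∧
    (∃ C : ℝ, ∀ (n : ℕ) (x : Matrix (Fin n) (Fin n) X),
      s.matNorm n x ≤ C * t.matNorm n (x.map u))

end Maps

/-! ### The two spaces -/

/-- The Hilbert space `ℓ₂`. -/
abbrev Ell2 : Type := lp (fun _ : ℕ => ℂ) 2

/-- A Banach space is Hilbertian if it is linearly homeomorphic to `ℓ₂`. -/
def IsHilbertian (X : Type) [NormedAddCommGroup X] [NormedSpace ℂ X] : Prop :=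
  Nonempty (X ≃L[ℂ] Ell2)

/-- The finite sets `S k` form a partition of `ℕ`. -/
structure IsFinitePartition (S : ℕ → Finset ℕ) : Prop where
  nonempty : ∀ k, (S k).Nonempty
  disjoint : Pairwise fun j k => Disjoint (S j) (S k)
  cover : ∀ i, ∃ k, i ∈ S k

/-- `ℓ₂(S)` for a finite set `S ⊆ ℕ`. -/
abbrev Ell2Block (S : Finset ℕ) : Type := EuclideanSpace ℂ S

/-- The restriction `x|_S ∈ ℓ₂(S)` of `x ∈ ℓ₂`. -/
def restrictBlock (S : Finset ℕ) (x : Ell2) : Ell2Block S :=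
  WithLp.toLp 2 fun i : S => x i

theorem norm_sq_restrictBlock (S : Finset ℕ) (x : Ell2) :
    ‖restrictBlock S x‖ ^ 2 = ∑ i ∈ S, ‖x i‖ ^ 2 := by
  rw [EuclideanSpace.norm_sq_eq, ← Finset.sum_coe_sort S fun i => ‖x i‖ ^ 2]
  rfl

theorem hasSum_norm_sq (x : Ell2) : HasSum (fun i => ‖x i‖ ^ 2) (‖x‖ ^ 2) := by
  have h := lp.hasSum_norm (p := 2) (by norm_num) x
  simpa using h

theorem norm_restrictBlock_le (S : Finset ℕ) (x : Ell2) : ‖restrictBlock S x‖ ≤ ‖x‖ := by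
  refine le_of_sq_le_sq ?_ (norm_nonneg x)
  rw [norm_sq_restrictBlock]
  exact sum_le_hasSum S (fun i _ => by positivity) (hasSum_norm_sq x)

theorem tendsto_norm_restrictBlock {S : ℕ → Finset ℕ} (hS : IsFinitePartition S) (x : Ell2) :
    Tendsto (fun k => ‖restrictBlock (S k) x‖) atTop (𝓝 0) := by
  have h : Summable fun k => ‖restrictBlock (S k) x‖ ^ 2 := by
    refine summable_of_sum_le (c := ‖x‖ ^ 2) (fun k => by positivity) fun F => ?_
    simp_rw [norm_sq_restrictBlock]
    rw [← Finset.sum_biUnion fun j _ k _ hjk => hS.disjoint hjk]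
    exact sum_le_hasSum _ (fun i _ => by positivity) (hasSum_norm_sq x)
  have h2 := (Real.continuous_sqrt.tendsto 0).comp h.tendsto_atTop_zero
  simpa [Function.comp_def, Real.sqrt_sq] using h2

/-- The isometric embedding
`x ↦ (x, (x|_{S_k})_k)` of `ℓ₂` into `ℓ₂ ⊕_∞ (⊕_k ℓ₂(S_k))_{c₀}`. -/
def blockEmbedding (S : ℕ → Finset ℕ) (hS : IsFinitePartition S) :
    Ell2 →ₗᵢ[ℂ] Ell2 × C0Sum fun k => Ell2Block (S k) where
  toFun x := (x, ⟨⟨fun k => restrictBlock (S k) x, memℓp_infty ⟨‖x‖, by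
    rintro _ ⟨k, rfl⟩
    exact norm_restrictBlock_le (S k) x⟩⟩, tendsto_norm_restrictBlock hS x⟩)
  map_add' x y := rfl
  map_smul' c x := rfl
  norm_map' x := by
    refine (Prod.norm_def _).trans (max_eq_left ?_)
    exact lp.norm_le_of_forall_le (norm_nonneg x) fun k => norm_restrictBlock_le (S k) x

/-- The operator space `X`: `ℓ₂` with the structure given by the isometric embedding
`x ↦ (x, (x|_{S_k})_k)` into `MIN(ℓ₂) ⊕ (⊕_k MAX(ℓ₂(S_k)))_{c₀}`. -/
def blockSpace (S : ℕ → Finset ℕ) (hS : IsFinitePartition S) : OperatorSpaceStructure Ell2 :=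
  ((OperatorSpaceStructure.MIN Ell2).prod
    (OperatorSpaceStructure.c0Sum fun k => OperatorSpaceStructure.MAX (Ell2Block (S k)))).ofEmbedding
    (blockEmbedding S hS)

/-- The operator space `Y = MIN(ℓ₂) ⊕ MAX(ℓ₂)`. -/
def minPlusMax : OperatorSpaceStructure (Ell2 × Ell2) :=
  (OperatorSpaceStructure.MIN Ell2).prod (OperatorSpaceStructure.MAX Ell2)

end OpSp

end

/-! The non-embedding is tested on the matrices `∑ A(e_k) ⊗ y_k` (`carMat`), where the `A(e_k)` are
real matrices satisfying the canonical anticommutation relations. The relations give `A(f)* A(f) +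
A(f) A(f)* = ‖f‖₂² · 1`, hence `‖A(f)‖ ≤ ‖f‖₂`. So for orthonormal `y_k` the test matrix has `MIN`
norm at most 1 (`IsCAR.min_carMat_le` with Bessel), while its `MAX` norm grows linearly in the
number of vectors: `∑ ‖y_k‖² ≤ 2K‖·‖` as soon as the `y_k` satisfy Bessel's inequality with constant
`K` (`IsCAR.le_max_carMat`).

Let `u = (T₁, T₂) : X → MIN(ℓ₂) ⊕ MAX(ℓ₂)` be bounded by `C` and its inverse by `D` at all matrix
levels. On a whole block `S_k` the space `X` sees `MAX(ℓ₂(S_k))`, so the test matrix has norm at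
least `|S_k|/2` (`IsCAR.card_le_blockSpace`). The `MIN` summand of `Y` accounts for at most `C`, so
in large blocks `T₂` must be big: some `i ∈ S_k` has `‖T₂ e_i‖ ≥ 1/(2D)`. Choose one such index in
each large block. Along this transversal every block sees at most one vector, so `X` looks like
`MIN` and the test matrix of any `N` of these unit vectors has norm at most 1
(`IsCAR.blockSpace_transversal_le`). Its image under `T₂` has `MAX` norm at most `C`, yet at least
`N/(8CD²)`, which is absurd for large `N`.

The embedding into `c₀(Y)` puts `x` itself into the `MIN` summand of one coordinate and the
restriction `x|_{S_k}`, extended by zero, into the `MAX` summand of the `k`-th. This loses nothing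
because `MAX(ℓ₂(S))` is the range of a contractive projection in `MAX(ℓ₂)`. -/

noncomputable section

namespace OpSp

/-! ### Canonical anticommutation relations -/

section CAR

/-- A linear family of matrices satisfying the canonical anticommutation relations, and with real
matrices at real vectors. -/
structure IsCAR {κ ι : Type} [Fintype κ] [Fintype ι] [DecidableEq ι]
    (A : (κ → ℂ) →ₗ[ℂ] Matrix ι ι ℂ) : Prop where
  anticomm : ∀ f g, A f * (A g).transpose + (A g).transpose * A f = (f ⬝ᵥ g) • 1
  conj : ∀ f, (A f).map star = A (star f)

/-- Jordan–Wigner doubling: each new generator doubles the size of the matrices. All matrices stay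
real, so the transpose can play the role of the adjoint and the relation is bilinear in `f` and `g`.
-/
theorem exists_isCAR_fin (N : ℕ) : ∃ (ι : Type) (_ : Fintype ι) (_ : DecidableEq ι) (_ : Nonempty ι)
    (A : (Fin N → ℂ) →ₗ[ℂ] Matrix ι ι ℂ), IsCAR A := by
  induction N with
  | zero =>
    exact ⟨Unit, inferInstance, inferInstance, inferInstance, 0, by simp, by simp⟩
  | succ N ih =>
    obtain ⟨ι, _, _, _, A, hA⟩ := ih
    refine ⟨ι ⊕ ι, inferInstance, inferInstance, inferInstance,
      -- The old family enters as `diag(A, -A)`; the sign makes it anticommute with the off-diagonal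
      -- block carrying the new coordinate `f 0`.
      { toFun := fun f => Matrix.fromBlocks (A (Fin.tail f)) (f 0 • 1) 0 (-A (Fin.tail f))
        map_add' := fun f g => ?_
        map_smul' := fun c f => ?_ }, fun f g => ?_, fun f => ?_⟩
    · have : Fin.tail (f + g) = Fin.tail f + Fin.tail g := rfl
      rw [this, Matrix.fromBlocks_add]
      simp [add_smul, add_comm]
    · have : Fin.tail (c • f) = c • Fin.tail f := rfl
      rw [this, Matrix.fromBlocks_smul]
      simp [smul_smul]
    · have h := hA.anticomm (Fin.tail f) (Fin.tail g)
      have h1 : f ⬝ᵥ g = f 0 * g 0 + Fin.tail f ⬝ᵥ Fin.tail g := by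
        simp [dotProduct, Fin.sum_univ_succ, Fin.tail]
      rw [h1, ← Matrix.fromBlocks_one, Matrix.fromBlocks_smul]
      simp only [LinearMap.coe_mk, AddHom.coe_mk, Matrix.fromBlocks_transpose,
        Matrix.fromBlocks_multiply, Matrix.fromBlocks_add, Matrix.transpose_smul,
        Matrix.transpose_one, Matrix.transpose_zero, Matrix.transpose_neg, add_smul, ← h]
      congr 1
      · simp [smul_smul, mul_comm (g 0)]; abel
      · simp
      · simp
      · simp [smul_smul]; abel
    · have h := hA.conj (Fin.tail f)
      have h1 : Fin.tail (star f) = star (Fin.tail f) := rfl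
      simp only [LinearMap.coe_mk, AddHom.coe_mk, Matrix.fromBlocks_map, h1, ← h]
      congr 1
      · ext p q
        by_cases h : p = q <;> simp [h]
      · ext p q
        simp

/-- Positivity of the size `n` matters: the trace identity is later divided by `n`. -/
theorem exists_isCAR (κ : Type) [Fintype κ] : ∃ (n : ℕ) (_ : 0 < n)
    (A : (κ → ℂ) →ₗ[ℂ] Matrix (Fin n) (Fin n) ℂ), IsCAR A := by
  obtain ⟨ι, _, _, _, A, hA⟩ := exists_isCAR_fin (Fintype.card κ)
  let e := Fintype.equivFin ι
  let d := Fintype.equivFin κ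
  refine ⟨Fintype.card ι, Fintype.card_pos,
    (Matrix.reindexLinearEquiv ℂ ℂ e e).toLinearMap ∘ₗ A ∘ₗ
      (LinearEquiv.funCongrLeft ℂ ℂ d.symm).toLinearMap, fun f g => ?_, fun f => ?_⟩
  · have h := congrArg (Matrix.reindexAlgEquiv ℂ ℂ e) (hA.anticomm (f ∘ d.symm) (g ∘ d.symm))
    rw [map_add, map_mul, map_mul, map_smul, map_one, comp_equiv_dotProduct_comp_equiv] at h
    exact h
  · exact congrArg (Matrix.reindex e e) (hA.conj (f ∘ d.symm))

variable {κ : Type} [Fintype κ] {n : ℕ} {A : (κ → ℂ) →ₗ[ℂ] Matrix (Fin n) (Fin n) ℂ}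

theorem IsCAR.conjTranspose (hA : IsCAR A) (f : κ → ℂ) :
    (A f).conjTranspose = (A (star f)).transpose := by
  rw [← hA.conj f]
  rfl

theorem IsCAR.anticomm_conjTranspose (hA : IsCAR A) (f : κ → ℂ) :
    (A f).conjTranspose * A f + A f * (A f).conjTranspose =
      ((∑ k, ‖f k‖ ^ 2 : ℝ) : ℂ) • 1 := by
  rw [hA.conjTranspose, add_comm, hA.anticomm]
  congr 1
  simp [dotProduct, Complex.mul_conj']

/-- The trace of the anticommutation relation. It is the source of the factor 2 in the lower bound
for `MAX`. -/
theorem IsCAR.sum_mul (hA : IsCAR A) (f g : κ → ℂ) :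
    2 * ∑ p, ∑ q, A f p q * A g p q = n * (f ⬝ᵥ g) := by
  have h := congrArg Matrix.trace (hA.anticomm f g)
  rw [Matrix.trace_add, Matrix.trace_mul_comm (A g).transpose, ← two_mul, Matrix.trace_smul,
    Matrix.trace_one, Fintype.card_fin, smul_eq_mul, mul_comm (f ⬝ᵥ g)] at h
  rw [← h]
  simp [Matrix.trace, Matrix.mul_apply]

variable {H : Type} [NormedAddCommGroup H] [InnerProductSpace ℂ H]

/-- This expands `‖(M ⊗ 1)ξ‖² = ⟨ξ, (M*M ⊗ 1)ξ⟩`, with vector coefficients so that it applies to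
amplifications. -/
theorem sum_norm_sq_matrix_smul (M : Matrix (Fin n) (Fin n) ℂ) (ξ : Fin n → H) :
    ((∑ p, ‖∑ q, M p q • ξ q‖ ^ 2 : ℝ) : ℂ) =
      ∑ q, ∑ r, (M.conjTranspose * M) q r * inner ℂ (ξ q) (ξ r) := by
  push_cast
  have h : ∀ p, ((‖∑ q, M p q • ξ q‖ : ℝ) : ℂ) ^ 2 =
      ∑ q, ∑ r, star (M p q) * M p r * inner ℂ (ξ q) (ξ r) := by
    intro p
    have := inner_self_eq_norm_sq_to_K (𝕜 := ℂ) (∑ q, M p q • ξ q)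
    refine this.symm.trans ?_
    rw [sum_inner]
    refine Finset.sum_congr rfl fun q _ => ?_
    rw [inner_sum]
    refine Finset.sum_congr rfl fun r _ => ?_
    rw [inner_smul_left, inner_smul_right, ← mul_assoc]
    rfl
  simp_rw [h, Matrix.mul_apply, Finset.sum_mul]
  rw [Finset.sum_comm]
  refine Finset.sum_congr rfl fun q _ => ?_
  rw [Finset.sum_comm]
  rfl

/-- Adding the expansions for `M` and `M*` gives exactly `c‖ξ‖²`, and the contribution of `M*` is
nonnegative. -/
theorem sum_norm_sq_matrix_smul_le {M : Matrix (Fin n) (Fin n) ℂ} {c : ℝ}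
    (hM : M.conjTranspose * M + M * M.conjTranspose = (c : ℂ) • 1) (ξ : Fin n → H) :
    ∑ p, ‖∑ q, M p q • ξ q‖ ^ 2 ≤ c * ∑ q, ‖ξ q‖ ^ 2 := by
  have h : ∑ p, ‖∑ q, M p q • ξ q‖ ^ 2 + ∑ p, ‖∑ q, M.conjTranspose p q • ξ q‖ ^ 2 =
      c * ∑ q, ‖ξ q‖ ^ 2 := by
    have h1 := sum_norm_sq_matrix_smul M ξ
    have h2 := sum_norm_sq_matrix_smul M.conjTranspose ξ
    rw [Matrix.conjTranspose_conjTranspose] at h2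
    apply Complex.ofReal_injective
    rw [Complex.ofReal_add, h1, h2, ← Finset.sum_add_distrib]
    simp_rw [← Finset.sum_add_distrib, ← add_mul, ← Matrix.add_apply, hM]
    simp [Matrix.one_apply, Finset.mul_sum, inner_self_eq_norm_sq_to_K]
  have : 0 ≤ ∑ p, ‖∑ q, M.conjTranspose p q • ξ q‖ ^ 2 := by positivity
  linarith

theorem IsCAR.norm_le (hA : IsCAR A) (f : κ → ℂ) :
    ‖Matrix.toEuclideanCLM (𝕜 := ℂ) (A f)‖ ≤ Real.sqrt (∑ k, ‖f k‖ ^ 2) := by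
  refine ContinuousLinearMap.opNorm_le_bound _ (Real.sqrt_nonneg _) fun ξ => ?_
  refine le_of_sq_le_sq ?_ (by positivity)
  rw [mul_pow, Real.sq_sqrt (by positivity), EuclideanSpace.norm_sq_eq, EuclideanSpace.norm_sq_eq]
  have := sum_norm_sq_matrix_smul_le (hA.anticomm_conjTranspose f) ξ.ofLp
  simpa [Matrix.mulVec, dotProduct] using this

end CAR

/-! ### Test matrices -/

section CarMat

variable {κ : Type} [Fintype κ] [DecidableEq κ] {n : ℕ} {E : Type} [NormedAddCommGroup E] [NormedSpace ℂ E]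

/-- The matrix `∑ k, A(e_k) ⊗ y_k` over the space in which the vectors `y_k` lie. -/
def carMat {E : Type} [AddCommGroup E] [Module ℂ E] (A : (κ → ℂ) →ₗ[ℂ] Matrix (Fin n) (Fin n) ℂ)
    (y : κ → E) : Matrix (Fin n) (Fin n) E :=
  Matrix.of fun p q => ∑ k, A (Pi.single k 1) p q • y k

variable (A : (κ → ℂ) →ₗ[ℂ] Matrix (Fin n) (Fin n) ℂ)

theorem carMat_map {E F : Type} [AddCommGroup E] [Module ℂ E] [AddCommGroup F] [Module ℂ F]
    (y : κ → E) (φ : E →ₗ[ℂ] F) :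
    (carMat A y).map φ = carMat A fun k => φ (y k) := by
  ext p q
  simp [carMat]

theorem carMat_scalar (z : κ → ℂ) : carMat A z = A z := by
  conv_rhs => rw [← Finset.univ_sum_single z, map_sum]
  ext p q
  rw [Matrix.sum_apply]
  refine Finset.sum_congr rfl fun k _ => ?_
  have : (Pi.single k (z k) : κ → ℂ) = z k • Pi.single k 1 := by
    rw [← Pi.single_smul]; simp
  rw [this, map_smul]
  simp [mul_comm]

variable {A}

/-- Triangle inequality over `k`: each term `A(e_k) ⊗ b_k` has norm at most `‖b_k‖` because `A(e_k)`
is a contraction. -/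
theorem IsCAR.norm_matOp_carMat_le (hA : IsCAR A) {H : Type} [NormedAddCommGroup H]
    [InnerProductSpace ℂ H] (b : κ → H →L[ℂ] H) : ‖matOp (carMat A b)‖ ≤ ∑ k, ‖b k‖ := by
  refine ContinuousLinearMap.opNorm_le_bound _ (by positivity) fun ξ => ?_
  have h : matOp (carMat A b) ξ = ∑ k, (WithLp.toLp 2 fun p =>
      ∑ q, A (Pi.single k 1) p q • b k (ξ q) : PiLp 2 fun _ : Fin n => H) := by
    ext p
    simp only [matOp_apply, carMat, Matrix.of_apply, WithLp.ofLp_sum, Finset.sum_apply,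
      sum_apply, smul_apply]
    exact Finset.sum_comm
  rw [h, Finset.sum_mul]
  refine (norm_sum_le _ _).trans (Finset.sum_le_sum fun k _ => ?_)
  refine le_of_sq_le_sq ?_ (by positivity)
  rw [mul_pow, PiLp.norm_sq_eq_of_L2, PiLp.norm_sq_eq_of_L2, Finset.mul_sum]
  have h1 := sum_norm_sq_matrix_smul_le (hA.anticomm_conjTranspose (Pi.single k 1))
    fun q => b k (ξ q)
  have h2 : ∑ j, ‖(Pi.single k 1 : κ → ℂ) j‖ ^ 2 = 1 := by
    rw [Finset.sum_eq_single k] <;> simp +contextual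
  rw [h2, one_mul] at h1
  refine h1.trans (Finset.sum_le_sum fun q _ => ?_)
  rw [← mul_pow]
  exact pow_le_pow_left₀ (norm_nonneg _) ((b k).le_opNorm _) 2

theorem IsCAR.matNorm_carMat_le [CompleteSpace E] (hA : IsCAR A) (s : OperatorSpaceStructure E)
    (y : κ → E) : s.matNorm n (carMat A y) ≤ ∑ k, ‖y k‖ := by
  obtain ⟨H, _, _, _, J, hJ⟩ := s.exists_embedding
  rw [hJ]
  have := hA.norm_matOp_carMat_le fun k => J (y k)
  simp only [J.norm_map] at this
  refine le_trans (le_of_eq ?_) this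
  exact congrArg (fun M : Matrix (Fin n) (Fin n) (H →L[ℂ] H) => ‖matOp M‖) (carMat_map A y J.toLinearMap)

/-- A functional `f` turns the test matrix into `A((f(y_k))_k)`, whose operator norm is at most the
Euclidean norm of `(f(y_k))_k`. -/
theorem IsCAR.min_carMat_le [CompleteSpace E] (hA : IsCAR A) (y : κ → E) {K : ℝ} (hK : 0 ≤ K)
    (h : ∀ f : E →L[ℂ] ℂ, ‖f‖ ≤ 1 → ∑ k, ‖f (y k)‖ ^ 2 ≤ K ^ 2) :
    (OperatorSpaceStructure.MIN E).matNorm n (carMat A y) ≤ K := by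
  have : Nonempty {f : E →L[ℂ] ℂ // ‖f‖ ≤ 1} := ⟨⟨0, by simp⟩⟩
  refine ciSup_le fun f => ?_
  have h1 : (carMat A y).map f.1 = A fun k => f.1 (y k) := by
    rw [← carMat_scalar]
    exact carMat_map A y f.1.toLinearMap
  rw [h1]
  refine (hA.norm_le _).trans ?_
  rw [Real.sqrt_le_left hK]
  exact h f.1 f.2

/-- The contraction `z ↦ K⁻¹ A((⟨y_k, z⟩)_k)` given by a CAR family. -/
def carMap {F : Type} [NormedAddCommGroup F] [InnerProductSpace ℂ F]
    (hA : IsCAR A) (y : κ → F) {K : ℝ} (hK : 0 < K)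
    (h : ∀ z, ∑ k, ‖inner ℂ (y k) z‖ ^ 2 ≤ (K * ‖z‖) ^ 2) :
    F →L[ℂ] EuclideanSpace ℂ (Fin n) →L[ℂ] EuclideanSpace ℂ (Fin n) :=
  LinearMap.mkContinuous (((K⁻¹ : ℝ) : ℂ) • (Matrix.toEuclideanCLM (n := Fin n)
    (𝕜 := ℂ)).toAlgEquiv.toLinearMap ∘ₗ A ∘ₗ LinearMap.pi fun k => (innerₛₗ ℂ (y k))) 1 fun z => by
    change ‖((K⁻¹ : ℝ) : ℂ) • Matrix.toEuclideanCLM (𝕜 := ℂ) (A fun k => inner ℂ (y k) z)‖ ≤ _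
    rw [norm_smul, Complex.norm_real, norm_inv, Real.norm_of_nonneg hK.le, one_mul,
      inv_mul_le_iff₀ hK]
    refine (hA.norm_le _).trans ?_
    rw [Real.sqrt_le_left (by positivity)]
    exact h z
-- The supremum defining `MAX` is tested on the single contraction `carMap`, and the resulting
-- operator on the single vector `∑ e_q ⊗ e_q`. Pairing the family `A` with itself there produces
-- the trace identity instead of the cancellation seen under `MIN`.
theorem IsCAR.le_max_carMat {F : Type} [NormedAddCommGroup F] [InnerProductSpace ℂ F]
    [CompleteSpace F] (hA : IsCAR A) (hn : 0 < n) (y : κ → F) {K : ℝ} (hK : 0 < K)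
    (h : ∀ z, ∑ k, ‖inner ℂ (y k) z‖ ^ 2 ≤ (K * ‖z‖) ^ 2) :
    ∑ k, ‖y k‖ ^ 2 ≤ 2 * K * (OperatorSpaceStructure.MAX F).matNorm n (carMat A y) := by
  let c := carMap hA y hK h
  suffices hs : ∑ k, ‖y k‖ ^ 2 ≤ 2 * K * ‖matOp ((carMat A y).map c)‖ from
    hs.trans (mul_le_mul_of_nonneg_left
      (le_ciSup (OperatorSpaceStructure.bddAbove_contraction F (carMat A y))
        ⟨EuclideanSpace ℂ (Fin n), c, LinearMap.mkContinuous_norm_le _ zero_le_one _⟩)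
      (by positivity))
  -- The unnormalised maximally entangled vector; its quadratic form sums the products of matching
  -- matrix entries.
  let ξ : PiLp 2 (fun _ : Fin n => EuclideanSpace ℂ (Fin n)) :=
    WithLp.toLp 2 fun q => EuclideanSpace.single q 1
  have hξ : ‖ξ‖ ^ 2 = n := by
    rw [PiLp.norm_sq_eq_of_L2]
    simp [ξ]
  have hu : ∀ z p q, c z (EuclideanSpace.single q 1) p =
      ((K⁻¹ : ℝ) : ℂ) * A (fun k => inner ℂ (y k) z) p q := by
    intro z p q
    change ((K⁻¹ : ℝ) : ℂ) * _ = _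
    congr 1
    simp [Matrix.mulVec, dotProduct]
    rfl
  have hin : (2 : ℂ) * inner ℂ ξ (matOp ((carMat A y).map c) ξ) =
      ((K⁻¹ * (n * ∑ k, ‖y k‖ ^ 2) : ℝ) : ℂ) := by
    -- Pairing with `e_k` in the trace identity extracts the diagonal Gram entry `⟨y_k, y_k⟩`.
    have h1 : ∀ k, 2 * ∑ p, ∑ q, A (Pi.single k 1) p q * A (fun j => inner ℂ (y j) (y k)) p q =
        n * ((‖y k‖ ^ 2 : ℝ) : ℂ) := by
      intro k
      rw [hA.sum_mul, single_one_dotProduct, inner_self_eq_norm_sq_to_K]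
      simp
    have h2 : inner ℂ ξ (matOp ((carMat A y).map c) ξ) =
        ∑ p, ∑ q, ∑ k, ((K⁻¹ : ℝ) : ℂ) *
          (A (Pi.single k 1) p q * A (fun j => inner ℂ (y j) (y k)) p q) := by
      rw [PiLp.inner_apply]
      refine Finset.sum_congr rfl fun p _ => ?_
      rw [matOp_apply]
      change inner ℂ (EuclideanSpace.single p 1) _ = _
      rw [EuclideanSpace.inner_single_left, map_one, one_mul, WithLp.ofLp_sum, Finset.sum_apply]
      refine Finset.sum_congr rfl fun q _ => ?_
      change c (carMat A y p q) (EuclideanSpace.single q 1) p = _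
      simp only [carMat, Matrix.of_apply, map_sum, map_smul, sum_apply,
        smul_apply, WithLp.ofLp_sum, Finset.sum_apply, WithLp.ofLp_smul,
        Pi.smul_apply, smul_eq_mul]
      refine Finset.sum_congr rfl fun k _ => ?_
      rw [hu]
      ring
    have h3 : ∑ p, ∑ q, ∑ k, ((K⁻¹ : ℝ) : ℂ) *
          (A (Pi.single k 1) p q * A (fun j => inner ℂ (y j) (y k)) p q) =
        ∑ k, ((K⁻¹ : ℝ) : ℂ) *
          ∑ p, ∑ q, (A (Pi.single k 1) p q * A (fun j => inner ℂ (y j) (y k)) p q) := by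
      simp_rw [Finset.mul_sum]
      rw [Finset.sum_comm' (t' := Finset.univ) (s' := fun _ => Finset.univ) (by simp)]
      simp_rw [Finset.sum_comm (s := (Finset.univ : Finset κ))]
      rw [Finset.sum_comm]
    rw [h2, h3, Finset.mul_sum, Complex.ofReal_mul, Complex.ofReal_mul, Complex.ofReal_sum,
      Finset.mul_sum, Finset.mul_sum]
    refine Finset.sum_congr rfl fun k _ => ?_
    rw [mul_left_comm, h1]
    simp
  have hle := (norm_inner_le_norm (𝕜 := ℂ) ξ
    (matOp ((carMat A y).map c) ξ)).trans
    (mul_le_mul_of_nonneg_left (ContinuousLinearMap.le_opNorm _ ξ) (norm_nonneg ξ))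
  have hnorm := congrArg norm hin
  rw [norm_mul, Complex.norm_real, Real.norm_of_nonneg (by positivity), Complex.norm_ofNat]
    at hnorm
  have hn' : (0 : ℝ) < n := by exact_mod_cast hn
  have h4 : K⁻¹ * (n * ∑ k, ‖y k‖ ^ 2) ≤ 2 * (n * ‖matOp ((carMat A y).map c)‖) := by
    rw [← hnorm, ← hξ]
    refine mul_le_mul_of_nonneg_left (hle.trans (le_of_eq ?_)) zero_le_two
    change ‖ξ‖ * (‖matOp ((carMat A y).map c)‖ * ‖ξ‖) = _
    ring
  rw [inv_mul_le_iff₀ hK] at h4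
  refine le_of_mul_le_mul_left (h4.trans (le_of_eq ?_)) hn'
  ring

end CarMat

/-! ### General bounds for matrix norms -/

namespace OperatorSpaceStructure

variable {X : Type} [NormedAddCommGroup X] [NormedSpace ℂ X] [CompleteSpace X]

theorem matNorm_nonneg (s : OperatorSpaceStructure X) {n : ℕ} (x : Matrix (Fin n) (Fin n) X) :
    0 ≤ s.matNorm n x := by
  obtain ⟨H, _, _, _, J, hJ⟩ := s.exists_embedding
  rw [hJ]
  exact norm_nonneg _

/-- A crude bound depending only on the norms of the entries: it makes the suprema over blocks
finite and shows that zero matrices have norm zero. -/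
theorem matNorm_le_sqrt (s : OperatorSpaceStructure X) {n : ℕ} (x : Matrix (Fin n) (Fin n) X) :
    s.matNorm n x ≤ Real.sqrt (∑ i : Fin n, (∑ j : Fin n, ‖x i j‖) ^ 2) := by
  obtain ⟨H, _, _, _, J, hJ⟩ := s.exists_embedding
  rw [hJ]
  refine (norm_matOp_le _).trans (le_of_eq ?_)
  simp

/-- A linear map that is completely bounded is bounded with the same constant. -/
theorem norm_map_le_of_matNorm_le {Y : Type} [NormedAddCommGroup Y] [NormedSpace ℂ Y]
    [CompleteSpace Y] (s : OperatorSpaceStructure X) (t : OperatorSpaceStructure Y)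
    (u : X →ₗ[ℂ] Y) {C : ℝ}
    (h : ∀ x : Matrix (Fin 1) (Fin 1) X, t.matNorm 1 (x.map u) ≤ C * s.matNorm 1 x) (x : X) :
    ‖u x‖ ≤ C * ‖x‖ := by
  have := h (Matrix.of fun _ _ => x)
  rw [s.matNorm_one] at this
  rwa [← t.matNorm_one]

end OperatorSpaceStructure

/-! ### Bessel inequalities for functionals and bounded operators -/

section Bessel

variable {κ E F : Type} [Fintype κ] [NormedAddCommGroup E] [InnerProductSpace ℂ E]
  [CompleteSpace E] [NormedAddCommGroup F] [InnerProductSpace ℂ F] [CompleteSpace F]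

theorem Orthonormal.sum_norm_sq_functional_le {v : κ → E} (hv : Orthonormal ℂ v)
    (g : E →L[ℂ] ℂ) : ∑ k, ‖g (v k)‖ ^ 2 ≤ ‖g‖ ^ 2 := by
  have h := hv.sum_inner_products_le ((InnerProductSpace.toDual ℂ E).symm g)
    (s := Finset.univ)
  rw [LinearIsometryEquiv.norm_map] at h
  refine le_trans (le_of_eq (Finset.sum_congr rfl fun k _ => ?_)) h
  rw [← InnerProductSpace.toDual_symm_apply, norm_inner_symm]

/-- Move `T` to the other side as its adjoint and apply Bessel to `T* z`. This supplies the
hypothesis of `IsCAR.le_max_carMat` with constant `K`. -/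
theorem Orthonormal.sum_norm_sq_inner_map_le {v : κ → E} (hv : Orthonormal ℂ v)
    (T : E →L[ℂ] F) {K : ℝ} (hT : ‖T‖ ≤ K) (z : F) :
    ∑ k, ‖inner ℂ (T (v k)) z‖ ^ 2 ≤ (K * ‖z‖) ^ 2 := by
  have h := hv.sum_inner_products_le (T.adjoint z) (s := Finset.univ)
  simp_rw [ContinuousLinearMap.adjoint_inner_right] at h
  refine h.trans (pow_le_pow_left₀ (norm_nonneg _) ?_ 2)
  refine (ContinuousLinearMap.le_opNorm _ _).trans ?_
  rw [LinearIsometryEquiv.norm_map]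
  gcongr

end Bessel

/-! ### `X` does not embed into `Y` -/

section NonEmbedding

/-- The unit vectors of `ℓ₂`. -/
def unitVec (i : ℕ) : Ell2 := lp.single 2 i (1 : ℂ)

theorem orthonormal_unitVec : Orthonormal ℂ unitVec := by
  rw [orthonormal_iff_ite]
  intro i j
  rw [unitVec, lp.inner_single_left, unitVec]
  rcases eq_or_ne i j with rfl | h
  · simp
  · simp [h]

/-- The restriction to a block as a linear map. -/
def restrictBlockₗ (S : Finset ℕ) : Ell2 →ₗ[ℂ] Ell2Block S where
  toFun := restrictBlock S
  map_add' _ _ := rfl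
  map_smul' _ _ := rfl

theorem restrictBlock_unitVec_of_mem {S : Finset ℕ} (i : S) :
    restrictBlock S (unitVec i) = EuclideanSpace.single i 1 := by
  ext j
  simp [restrictBlock, unitVec, Pi.single_apply]

theorem restrictBlock_unitVec_of_notMem {S : Finset ℕ} {i : ℕ} (hi : i ∉ S) :
    restrictBlock S (unitVec i) = 0 := by
  ext j
  have : (j : ℕ) ≠ i := fun h => hi (h ▸ j.2)
  simp [restrictBlock, unitVec, this]

variable {S : ℕ → Finset ℕ} (hS : IsFinitePartition S)

theorem blockSpace_matNorm {n : ℕ} (x : Matrix (Fin n) (Fin n) Ell2) :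
    (blockSpace S hS).matNorm n x = max ((OperatorSpaceStructure.MIN Ell2).matNorm n x)
      (⨆ k, (OperatorSpaceStructure.MAX (Ell2Block (S k))).matNorm n
        (x.map (restrictBlock (S k)))) := rfl

theorem bddAbove_restrictBlock {n : ℕ} (x : Matrix (Fin n) (Fin n) Ell2) :
    BddAbove (Set.range fun k => (OperatorSpaceStructure.MAX (Ell2Block (S k))).matNorm n
        (x.map (restrictBlock (S k)))) := by
  refine ⟨Real.sqrt (∑ i : Fin n, (∑ j : Fin n, ‖x i j‖) ^ 2), ?_⟩
  rintro _ ⟨k, rfl⟩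
  refine (OperatorSpaceStructure.matNorm_le_sqrt _ _).trans (Real.sqrt_le_sqrt ?_)
  gcongr with i _ j _
  exact norm_restrictBlock_le _ _

variable {n : ℕ}

/-- The `MIN` part is at most 1 by Bessel. Each block contains at most one of the chosen indices, so
in its `MAX` part at most one term survives, of norm at most 1. -/
theorem IsCAR.blockSpace_transversal_le {κ : Type} [Fintype κ] [DecidableEq κ]
    {A : (κ → ℂ) →ₗ[ℂ] Matrix (Fin n) (Fin n) ℂ} (hA : IsCAR A) (i : κ → ℕ)
    (hi : Function.Injective i) (ht : ∀ k a b, i a ∈ S k → i b ∈ S k → a = b) :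
    (blockSpace S hS).matNorm n (carMat A fun j => unitVec (i j)) ≤ 1 := by
  rw [blockSpace_matNorm]
  refine max_le ?_ (ciSup_le fun k => ?_)
  · refine hA.min_carMat_le _ zero_le_one fun f hf => ?_
    refine (Orthonormal.sum_norm_sq_functional_le (orthonormal_unitVec.comp i hi) f).trans ?_
    exact pow_le_pow_left₀ (norm_nonneg _) hf 2
  · have := carMat_map A (fun j => unitVec (i j)) (restrictBlockₗ (S k))
    change (OperatorSpaceStructure.MAX (Ell2Block (S k))).matNorm n
      ((carMat A fun j => unitVec (i j)).map (restrictBlockₗ (S k))) ≤ 1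
    rw [this]
    refine (hA.matNorm_carMat_le _ _).trans ?_
    change ∑ j, ‖restrictBlock (S k) (unitVec (i j))‖ ≤ 1
    by_cases h : ∃ a, i a ∈ S k
    · obtain ⟨a, ha⟩ := h
      rw [Finset.sum_eq_single a]
      · exact (norm_restrictBlock_le _ _).trans (orthonormal_unitVec.1 _).le
      · intro b _ hb
        rw [restrictBlock_unitVec_of_notMem fun h => hb (ht k b a h ha), norm_zero]
      · simp
    · push Not at h
      simp [restrictBlock_unitVec_of_notMem (h _)]

/-- The `k`-th `MAX` coordinate sees an orthonormal family of `|S_k|` vectors, for which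
`IsCAR.le_max_carMat` holds with `K = 1`. -/
theorem IsCAR.card_le_blockSpace {k : ℕ} {A : (S k → ℂ) →ₗ[ℂ] Matrix (Fin n) (Fin n) ℂ}
    (hA : IsCAR A) (hn : 0 < n) :
    ((S k).card : ℝ) ≤ 2 * (blockSpace S hS).matNorm n (carMat A fun i => unitVec i) := by
  have ho : Orthonormal ℂ fun i : S k => restrictBlock (S k) (unitVec i) := by
    simp_rw [restrictBlock_unitVec_of_mem]
    exact EuclideanSpace.orthonormal_single
  have h := hA.le_max_carMat hn (fun i : S k => restrictBlock (S k) (unitVec i)) one_pos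
    (Orthonormal.sum_norm_sq_inner_map_le ho (ContinuousLinearMap.id ℂ _)
      ContinuousLinearMap.norm_id_le)
  simp_rw [ho.1] at h
  have hm : (carMat A fun i : S k => unitVec i).map (restrictBlock (S k)) =
      carMat A fun i : S k => restrictBlock (S k) (unitVec i) :=
    carMat_map A (fun i : S k => unitVec i) (restrictBlockₗ (S k))
  rw [← hm] at h
  simp only [one_pow, Finset.sum_const, Finset.card_univ, Fintype.card_coe, nsmul_eq_mul,
    mul_one] at h
  refine h.trans (mul_le_mul_of_nonneg_left ?_ zero_le_two)
  rw [blockSpace_matNorm]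
  exact le_max_of_le_right (le_ciSup (bddAbove_restrictBlock (S := S)
    (carMat A fun i : S k => unitVec i)) k)

theorem not_completelyIsomorphicallyEmbeds_minPlusMax
    (hcard : Tendsto (fun k => (S k).card) atTop atTop) :
    ¬ CompletelyIsomorphicallyEmbeds (blockSpace S hS) minPlusMax := by
  rintro ⟨u, -, ⟨C₀, hC₀⟩, ⟨D₀, hD₀⟩⟩
  obtain ⟨C, hC, hCpos⟩ : ∃ C, (∀ n (x : Matrix (Fin n) (Fin n) Ell2),
      minPlusMax.matNorm n (x.map u) ≤ C * (blockSpace S hS).matNorm n x) ∧ 0 < C :=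
    -- The given constants carry no sign; enlarging them makes them positive.
    ⟨max C₀ 1, fun n x => (hC₀ n x).trans (mul_le_mul_of_nonneg_right (le_max_left _ _)
      (OperatorSpaceStructure.matNorm_nonneg _ _)), by positivity⟩
  obtain ⟨D, hD, hDpos⟩ : ∃ D, (∀ n (x : Matrix (Fin n) (Fin n) Ell2),
      (blockSpace S hS).matNorm n x ≤ D * minPlusMax.matNorm n (x.map u)) ∧ 0 < D :=
    ⟨max D₀ 1, fun n x => (hD₀ n x).trans (mul_le_mul_of_nonneg_right (le_max_left _ _)
      (OperatorSpaceStructure.matNorm_nonneg _ _)), by positivity⟩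
  have hu := OperatorSpaceStructure.norm_map_le_of_matNorm_le _ _ u (hC 1)
  let T₁ : Ell2 →L[ℂ] Ell2 := (LinearMap.fst ℂ Ell2 Ell2 ∘ₗ u).mkContinuous C fun x =>
    (norm_fst_le (u x)).trans (hu x)
  let T₂ : Ell2 →L[ℂ] Ell2 := (LinearMap.snd ℂ Ell2 Ell2 ∘ₗ u).mkContinuous C fun x =>
    (norm_snd_le (u x)).trans (hu x)
  have hT₁ : ‖T₁‖ ≤ C := LinearMap.mkContinuous_norm_le _ hCpos.le _
  have hT₂ : ‖T₂‖ ≤ C := LinearMap.mkContinuous_norm_le _ hCpos.le _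
  have hmax : ∀ n (x : Matrix (Fin n) (Fin n) Ell2), minPlusMax.matNorm n (x.map u) =
      max ((OperatorSpaceStructure.MIN Ell2).matNorm n (x.map T₁.toLinearMap))
        ((OperatorSpaceStructure.MAX Ell2).matNorm n (x.map T₂.toLinearMap)) := fun n x => rfl
  -- The `MIN` component contributes at most `C`, so in a block with more than `2DC` elements the
  -- `MAX` component must account for the size of the test matrix.
  have step : ∀ k, 2 * D * C < (S k).card → ∃ i ∈ S k, 1 ≤ 2 * D * ‖T₂ (unitVec i)‖ := by
    intro k hk
    obtain ⟨n, hn, A, hA⟩ := exists_isCAR (S k)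
    have h := (hA.card_le_blockSpace hS hn).trans
      (mul_le_mul_of_nonneg_left (hD n _) zero_le_two)
    rw [hmax, carMat_map, carMat_map, ← mul_assoc, mul_max_of_nonneg _ _ (by positivity)] at h
    have h1 : (OperatorSpaceStructure.MIN Ell2).matNorm n
        (carMat A fun i : S k => T₁ (unitVec i)) ≤ C := by
      refine hA.min_carMat_le _ hCpos.le fun f hf => ?_
      refine (Orthonormal.sum_norm_sq_functional_le
        (orthonormal_unitVec.comp _ Subtype.val_injective) (f ∘L T₁)).trans ?_
      refine pow_le_pow_left₀ (norm_nonneg _) ((f.opNorm_comp_le T₁).trans ?_) 2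
      exact (mul_le_of_le_one_left (norm_nonneg _) hf).trans hT₁
    have h2 := hA.matNorm_carMat_le (OperatorSpaceStructure.MAX Ell2)
      fun i : S k => T₂ (unitVec i)
    rcases le_max_iff.1 h with h | h
    · exact absurd (h.trans (mul_le_mul_of_nonneg_left h1 (by positivity))) hk.not_ge
    · by_contra! hlt
      have h3 := h.trans (mul_le_mul_of_nonneg_left h2 (by positivity))
      -- Non-emptiness of the block keeps the summed inequality strict, against `|S_k| ≤ 2D ∑ ‖T₂
      -- e_i‖`.
      have : Nonempty (S k) := (hS.nonempty k).to_subtype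
      have h4 : ∑ i : S k, 2 * D * ‖T₂ (unitVec i)‖ < ∑ i : S k, 1 :=
        Finset.sum_lt_sum_of_nonempty Finset.univ_nonempty fun i _ => hlt i i.2
      rw [← Finset.mul_sum] at h4
      simp only [Finset.sum_const, Finset.card_univ, Fintype.card_coe, nsmul_eq_mul,
        mul_one] at h4
      exact h3.not_gt h4
  obtain ⟨k₀, hk₀⟩ := eventually_atTop.1
    ((tendsto_natCast_atTop_atTop.comp hcard).eventually_gt_atTop (2 * D * C))
  -- One index from each block beyond `k₀`: a transversal along which `T₂` is bounded below.
  choose i hiS hi using fun j : ℕ => step (k₀ + j) (hk₀ _ (Nat.le_add_right _ _))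
  have hsep : ∀ k a b, i a ∈ S k → i b ∈ S k → a = b := by
    have : ∀ k a, i a ∈ S k → k₀ + a = k := fun k a ha => by
      by_contra hne
      exact Finset.disjoint_left.1 (hS.disjoint hne) (hiS a) ha
    intro k a b ha hb
    have h1 := this k a ha
    have h2 := this k b hb
    omega
  have hinj : Function.Injective i := fun a b hab => hsep _ a b (hiS a) (hab ▸ hiS a)
  -- The final chain is `N ≤ (2D)² ∑ ‖T₂ e_i‖² ≤ (2D)² · 2C · C`: one `C` is the Bessel constant of
  -- `T₂`, the other bounds the `MAX` norm of the image.
  obtain ⟨N, hN⟩ := exists_nat_gt ((2 * D) ^ 2 * (2 * C * C))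
  obtain ⟨n, hn, A, hA⟩ := exists_isCAR (Fin N)
  have h1 := hA.blockSpace_transversal_le hS (fun j : Fin N => i j)
    (hinj.comp Fin.val_injective) fun k a b ha hb => Fin.ext (hsep k a b ha hb)
  have h2 := hA.le_max_carMat hn (fun j : Fin N => T₂ (unitVec (i j))) hCpos
    (Orthonormal.sum_norm_sq_inner_map_le
      (orthonormal_unitVec.comp _ (hinj.comp Fin.val_injective)) T₂ hT₂)
  have h3 : (OperatorSpaceStructure.MAX Ell2).matNorm n
      (carMat A fun j : Fin N => T₂ (unitVec (i j))) ≤ C := by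
    have h := (hC n (carMat A fun j : Fin N => unitVec (i j))).trans
      (mul_le_mul_of_nonneg_left h1 hCpos.le)
    rw [hmax, mul_one, carMat_map A _ T₂.toLinearMap] at h
    exact (le_max_right _ _).trans h
  have h4 : (N : ℝ) ≤ (2 * D) ^ 2 * ∑ j : Fin N, ‖T₂ (unitVec (i j))‖ ^ 2 := by
    rw [Finset.mul_sum]
    have : ∑ j : Fin N, (1 : ℝ) ≤ ∑ j : Fin N, (2 * D) ^ 2 * ‖T₂ (unitVec (i j))‖ ^ 2 :=
      Finset.sum_le_sum fun j _ => by
        rw [← mul_pow]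
        exact one_le_pow₀ (hi j)
    simpa using this
  have h5 := h2.trans (mul_le_mul_of_nonneg_left h3 (by positivity))
  exact (h4.trans (mul_le_mul_of_nonneg_left h5 (by positivity))).not_gt hN

end NonEmbedding

/-! ### `X` embeds completely isometrically into `c₀(Y)` -/

section Embedding

namespace OperatorSpaceStructure

variable {E F : Type} [NormedAddCommGroup E] [NormedSpace ℂ E] [CompleteSpace E]
  [NormedAddCommGroup F] [NormedSpace ℂ F] [CompleteSpace F]

/-- Composing a contraction of `F` with `T` yields a contraction of `E`, hence a competitor in the
supremum for `MAX E`. -/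
theorem MAX_matNorm_map_le (T : E →ₗ[ℂ] F) (hT : ∀ x, ‖T x‖ ≤ ‖x‖) {n : ℕ}
    (x : Matrix (Fin n) (Fin n) E) : (MAX F).matNorm n (x.map T) ≤ (MAX E).matNorm n x := by
  have : Nonempty (Contraction F) := ⟨functionalContraction F ⟨0, by simp⟩⟩
  refine ciSup_le fun c => ?_
  let T' : E →L[ℂ] F := T.mkContinuous 1 fun x => by simpa using hT x
  refine le_ciSup (bddAbove_contraction E x) ⟨c.H, c.u ∘L T', ?_⟩
  refine (ContinuousLinearMap.opNorm_comp_le _ _).trans ?_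
  exact mul_le_one₀ c.norm_le (norm_nonneg _) (LinearMap.mkContinuous_norm_le _ zero_le_one _)

end OperatorSpaceStructure

/-- The extension by zero of a vector of `ℓ₂(S)`. -/
def extendBlock (S : Finset ℕ) : Ell2Block S →ₗ[ℂ] Ell2 where
  toFun y := ∑ i : S, y i • unitVec i
  map_add' y z := by simp [add_smul, Finset.sum_add_distrib]
  map_smul' a y := by simp [mul_smul, Finset.smul_sum]

theorem norm_extendBlock (S : Finset ℕ) (y : Ell2Block S) : ‖extendBlock S y‖ = ‖y‖ := by
  have h := (orthonormal_unitVec.comp _ (Subtype.val_injective (p := fun i => i ∈ S))).inner_sum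
    (fun i => y i) (fun i => y i) Finset.univ
  have h1 : inner ℂ (extendBlock S y) (extendBlock S y) = ((∑ i, ‖y i‖ ^ 2 : ℝ) : ℂ) := by
    refine h.trans ?_
    simp [Complex.conj_mul']
  rw [inner_self_eq_norm_sq_to_K] at h1
  have h2 : ‖extendBlock S y‖ ^ 2 = ∑ i, ‖y i‖ ^ 2 := by
    apply Complex.ofReal_injective
    rw [← h1]
    push_cast
    rfl
  rw [← EuclideanSpace.norm_sq_eq] at h2
  exact (sq_eq_sq₀ (norm_nonneg _) (norm_nonneg _)).1 h2

theorem restrictBlock_extendBlock (S : Finset ℕ) (y : Ell2Block S) :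
    restrictBlock S (extendBlock S y) = y := by
  change restrictBlockₗ S (∑ i : S, y i • unitVec i) = y
  rw [map_sum]
  simp_rw [map_smul]
  change ∑ i : S, y i • restrictBlock S (unitVec i) = y
  simp_rw [restrictBlock_unitVec_of_mem]
  simpa using (EuclideanSpace.basisFun S ℂ).sum_repr y

variable {S : ℕ → Finset ℕ} (hS : IsFinitePartition S)

/-- The components of the embedding of `X` into `c₀(Y)`. -/
def blockComponent (S : ℕ → Finset ℕ) (k : ℕ) : Ell2 →ₗ[ℂ] Ell2 × Ell2 :=
  LinearMap.prod (if k = 0 then LinearMap.id else 0) (extendBlock (S k) ∘ₗ restrictBlockₗ (S k))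

theorem norm_blockComponent_snd (k : ℕ) (x : Ell2) :
    ‖(blockComponent S k x).2‖ = ‖restrictBlock (S k) x‖ :=
  norm_extendBlock _ _

theorem norm_blockComponent_le (k : ℕ) (x : Ell2) : ‖blockComponent S k x‖ ≤ ‖x‖ := by
  refine max_le ?_ ((norm_blockComponent_snd k x).trans_le (norm_restrictBlock_le _ _))
  change ‖(if k = 0 then LinearMap.id else 0 : Ell2 →ₗ[ℂ] Ell2) x‖ ≤ ‖x‖
  split_ifs <;> simp

/-- The full vector `x` occurs only in coordinate 0, so from `k = 1` on only the block norms remain.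
-/
theorem tendsto_norm_blockComponent (hS : IsFinitePartition S) (x : Ell2) :
    Tendsto (fun k => ‖blockComponent S k x‖) atTop (𝓝 0) := by
  refine (tendsto_norm_restrictBlock hS x).congr' ?_
  filter_upwards [eventually_ge_atTop 1] with k hk
  have h : (blockComponent S k x).1 = 0 := by
    change (if k = 0 then LinearMap.id else 0 : Ell2 →ₗ[ℂ] Ell2) x = 0
    rw [if_neg (by omega)]
    rfl
  rw [Prod.norm_def, h, norm_blockComponent_snd, norm_zero, max_eq_right (norm_nonneg _)]

/-- The embedding `x ↦ (δ_{k0} x, x|_{S_k})_k` of `X` into `c₀(Y)`. -/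
def c0Embedding (hS : IsFinitePartition S) : Ell2 →ₗ[ℂ] C0Sum fun _ : ℕ => Ell2 × Ell2 where
  toFun x := ⟨⟨fun k => blockComponent S k x, memℓp_infty ⟨‖x‖, by
    rintro _ ⟨k, rfl⟩
    exact norm_blockComponent_le k x⟩⟩, tendsto_norm_blockComponent hS x⟩
  map_add' x y := by
    refine Subtype.ext (Subtype.ext (funext fun k => ?_))
    exact map_add (blockComponent S k) x y
  map_smul' a x := by
    refine Subtype.ext (Subtype.ext (funext fun k => ?_))
    exact map_smul (blockComponent S k) a x

/-- Extension by zero and restriction are contractions and restriction undoes extension, so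
functoriality of `MAX` in both directions gives equal `MAX` norms over `ℓ₂(S_k)` and `ℓ₂`. -/
theorem matNorm_c0Embedding {n : ℕ} (x : Matrix (Fin n) (Fin n) Ell2) :
    minPlusMax.c0.matNorm n (x.map (c0Embedding hS)) = (blockSpace S hS).matNorm n x := by
  have h0 : minPlusMax.c0.matNorm n (x.map (c0Embedding hS)) =
      ⨆ k, minPlusMax.matNorm n (x.map (blockComponent S k)) := rfl
  have h1 : ∀ k, minPlusMax.matNorm n (x.map (blockComponent S k)) =
      max ((OperatorSpaceStructure.MIN Ell2).matNorm n
          (x.map (if k = 0 then LinearMap.id else 0 : Ell2 →ₗ[ℂ] Ell2)))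
        ((OperatorSpaceStructure.MAX Ell2).matNorm n
          ((x.map (restrictBlock (S k))).map (extendBlock (S k)))) := fun k => rfl
  have h2 : ∀ k, (OperatorSpaceStructure.MAX Ell2).matNorm n
      ((x.map (restrictBlock (S k))).map (extendBlock (S k))) =
      (OperatorSpaceStructure.MAX (Ell2Block (S k))).matNorm n
        (x.map (restrictBlock (S k))) := by
    intro k
    apply le_antisymm
    · exact OperatorSpaceStructure.MAX_matNorm_map_le _ (fun y => (norm_extendBlock _ y).le) _
    · have := OperatorSpaceStructure.MAX_matNorm_map_le (restrictBlockₗ (S k))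
        (norm_restrictBlock_le (S k)) ((x.map (restrictBlock (S k))).map (extendBlock (S k)))
      refine le_trans (le_of_eq ?_) this
      congr 1
      ext1 p q
      exact (restrictBlock_extendBlock _ _).symm
  have hbdd : BddAbove (Set.range fun k => minPlusMax.matNorm n (x.map (blockComponent S k))) := by
    refine ⟨Real.sqrt (∑ i : Fin n, (∑ j : Fin n, ‖x i j‖) ^ 2), ?_⟩
    rintro _ ⟨k, rfl⟩
    refine (OperatorSpaceStructure.matNorm_le_sqrt _ _).trans (Real.sqrt_le_sqrt ?_)
    gcongr with i _ j _
    exact norm_blockComponent_le k _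
  rw [h0, blockSpace_matNorm]
  apply le_antisymm
  · refine ciSup_le fun k => ?_
    rw [h1, h2]
    refine max_le_max ?_ (le_ciSup (bddAbove_restrictBlock x) k)
    split_ifs
    · exact le_rfl
    -- For `k ≠ 0` the first component is the zero matrix.
    · refine (OperatorSpaceStructure.matNorm_le_sqrt _ _).trans ?_
      simpa using OperatorSpaceStructure.matNorm_nonneg _ x
  · refine max_le ?_ (ciSup_le fun k => ?_)
    -- Coordinate 0 is the one that carries the `MIN` norm.
    · refine le_trans ?_ (le_ciSup hbdd 0)
      rw [h1]
      exact le_max_left _ _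
    · refine le_trans ?_ (le_ciSup hbdd k)
      rw [h1, h2]
      exact le_max_right _ _

end Embedding

/-! ### Separability and Hilbertian sums -/

section Hilbertian

theorem separableSpace_ell2 : TopologicalSpace.SeparableSpace Ell2 := by
  let b : HilbertBasis ℕ ℂ Ell2 := ⟨LinearIsometryEquiv.refl ℂ _⟩
  have h := ((Set.countable_range b).isSeparable.span (R := ℂ)).closure
  rw [← Submodule.topologicalClosure_coe, b.dense_span] at h
  exact TopologicalSpace.isSeparable_univ_iff.1 h

/-- The unit vectors of both summands of `ℓ₂ ⊕ ℓ₂`. -/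
def prodUnitVec : ℕ ⊕ ℕ → WithLp 2 (Ell2 × Ell2) :=
  Sum.elim (fun i => WithLp.toLp 2 (unitVec i, 0)) fun i => WithLp.toLp 2 (0, unitVec i)

theorem orthonormal_prodUnitVec : Orthonormal ℂ prodUnitVec := by
  have h := orthonormal_iff_ite.1 orthonormal_unitVec
  rw [orthonormal_iff_ite]
  rintro (i | i) (j | j) <;> simp [prodUnitVec, WithLp.prod_inner_apply, h]

/-- The maximum norm is equivalent to the `ℓ₂`-sum norm, and the latter has an orthonormal basis
indexed by `ℕ ⊕ ℕ ≃ ℕ`. -/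
theorem isHilbertian_prod : IsHilbertian (Ell2 × Ell2) := by
  let e : ℕ ≃ ℕ ⊕ ℕ := Equiv.natSumNatEquivNat.symm
  have h : (Submodule.span ℂ (Set.range (prodUnitVec ∘ e)))ᗮ = ⊥ := by
    rw [e.surjective.range_comp, Submodule.eq_bot_iff]
    intro x hx
    have hx' : ∀ i, inner ℂ (prodUnitVec i) x = 0 := fun i =>
      (Submodule.mem_orthogonal _ _).1 hx _ (Submodule.subset_span ⟨i, rfl⟩)
    have h1 : x.fst = 0 := by
      ext i
      simpa [prodUnitVec, WithLp.prod_inner_apply, unitVec, lp.inner_single_left]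
        using hx' (Sum.inl i)
    have h2 : x.snd = 0 := by
      ext i
      simpa [prodUnitVec, WithLp.prod_inner_apply, unitVec, lp.inner_single_left]
        using hx' (Sum.inr i)
    exact WithLp.ofLp_injective 2 (Prod.ext h1 h2)
  let b := HilbertBasis.mkOfOrthogonalEqBot (orthonormal_prodUnitVec.comp e e.injective) h
  exact ⟨(WithLp.prodContinuousLinearEquiv 2 ℂ Ell2 Ell2).symm.trans
    b.repr.toContinuousLinearEquiv⟩

end Hilbertian

/-! ### A concrete partition for the existence statement -/

section Partition

/-- The partition of `ℕ` into the intervals between consecutive squares. -/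
def squareBlock (k : ℕ) : Finset ℕ := Finset.Ico (k ^ 2) ((k + 1) ^ 2)

/-- The blocks are the fibres of `Nat.sqrt`, so disjointness and covering are immediate. -/
theorem mem_squareBlock {i k : ℕ} : i ∈ squareBlock k ↔ Nat.sqrt i = k := by
  rw [squareBlock, Finset.mem_Ico, Nat.eq_sqrt'.symm.trans eq_comm]

theorem isFinitePartition_squareBlock : IsFinitePartition squareBlock where
  nonempty k := ⟨k ^ 2, mem_squareBlock.2 (Nat.sqrt_eq' k)⟩
  disjoint _ _ hjk := Finset.disjoint_left.2 fun _ hj hk =>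
    hjk ((mem_squareBlock.1 hj).symm.trans (mem_squareBlock.1 hk))
  cover i := ⟨Nat.sqrt i, mem_squareBlock.2 rfl⟩

theorem tendsto_card_squareBlock : Tendsto (fun k => (squareBlock k).card) atTop atTop := by
  refine tendsto_atTop_mono (fun k => ?_) tendsto_id
  -- The block has `(k + 1)² - k² = 2k + 1` elements; the bound by `k` is enough.
  rw [squareBlock, Nat.card_Ico, id, Nat.le_sub_iff_add_le (by gcongr; omega)]
  nlinarith

end Partition

end OpSp

end

/-! ### The theorem -/

theorem mainTheorem6 :
    (∃ (X : Type) (_ : NormedAddCommGroup X) (_ : NormedSpace ℂ X) (_ : CompleteSpace X)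
      (Y : Type) (_ : NormedAddCommGroup Y) (_ : NormedSpace ℂ Y) (_ : CompleteSpace Y)
      (s : OpSp.OperatorSpaceStructure X) (t : OpSp.OperatorSpaceStructure Y),
      TopologicalSpace.SeparableSpace X ∧ OpSp.IsHilbertian X ∧
      TopologicalSpace.SeparableSpace Y ∧ OpSp.IsHilbertian Y ∧
      OpSp.CompletelyIsometricallyEmbeds s t.c0 ∧
      ¬ OpSp.CompletelyIsomorphicallyEmbeds s t) ∧
    (TopologicalSpace.SeparableSpace OpSp.Ell2 ∧ OpSp.IsHilbertian OpSp.Ell2 ∧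
      TopologicalSpace.SeparableSpace (OpSp.Ell2 × OpSp.Ell2) ∧
      OpSp.IsHilbertian (OpSp.Ell2 × OpSp.Ell2) ∧
      ∀ (S : ℕ → Finset ℕ) (hS : OpSp.IsFinitePartition S),
        Tendsto (fun k => (S k).card) atTop atTop →
          OpSp.CompletelyIsometricallyEmbeds (OpSp.blockSpace S hS) OpSp.minPlusMax.c0 ∧
          ¬ OpSp.CompletelyIsomorphicallyEmbeds (OpSp.blockSpace S hS) OpSp.minPlusMax) := by
  have hsep := OpSp.separableSpace_ell2
  have hH : OpSp.IsHilbertian OpSp.Ell2 := ⟨ContinuousLinearEquiv.refl ℂ _⟩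
  have hembed : ∀ (S : ℕ → Finset ℕ) (hS : OpSp.IsFinitePartition S),
      OpSp.CompletelyIsometricallyEmbeds (OpSp.blockSpace S hS) OpSp.minPlusMax.c0 :=
    fun S hS => ⟨OpSp.c0Embedding hS, fun _ x => OpSp.matNorm_c0Embedding hS x⟩
  refine ⟨?_, hsep, hH, inferInstance, OpSp.isHilbertian_prod, fun S hS hcard =>
    ⟨hembed S hS, OpSp.not_completelyIsomorphicallyEmbeds_minPlusMax hS hcard⟩⟩
  exact ⟨OpSp.Ell2, inferInstance, inferInstance, inferInstance, OpSp.Ell2 × OpSp.Ell2,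
    inferInstance, inferInstance, inferInstance,
    OpSp.blockSpace _ OpSp.isFinitePartition_squareBlock, OpSp.minPlusMax,
    hsep, hH, inferInstance, OpSp.isHilbertian_prod, hembed _ _,
    OpSp.not_completelyIsomorphicallyEmbeds_minPlusMax _ OpSp.tendsto_card_squareBlock⟩
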